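/- Let $p$ be a prime number and let $X$ be an integral normal noetherian $\mathbb{F}_p$-scheme which is $F$-finite, i.e. whose absolute Frobenius morphism $F_X : X \to X$ (the identity on the underlying space and $a \mapsto a^p$ on sections) is finite. Let $K(X)$ be the function field of $X$, and let $D$ be an $\mathbb{R}$-divisor on $X$, i.e. a finite formal $\mathbb{R}$-linear combination of prime divisors of $X$. For an integer $n \geq 1$ let $W_n$ denote the ring of $p$-typical Witt vectors of length $n$, and let $W_n\mathcal{O}_X$ be the sheaf of rings $U \mapsto W_n(\Gamma(U, \mathcal{O}_X))$ on $X$. Let $W_n\mathcal{O}_X(D)$ be the subsheaf of the constant sheaf $W_n(K(X))$ on $X$ given by $$\Gamma(U, W_n\mathcal{O}_X(D)) = \{(\varphi_0, \ldots, \varphi_{n-1}) \in W_n(K(X)) \mid (\mathrm{div}(\varphi_i) + p^i D)|_U \geq 0 \text{ for all } 0 \leq i \leq n-1\}$$ for every non-empty open subset $U \subseteq X$, where $\mathrm{div}(\varphi_i)$ is the principal divisor of $\varphi_i$ and the condition is regarded as satisfied if $\varphi_i = 0$; it is a sheaf of $W_n\mathcal{O}_X$-submodules of $W_n(K(X))$.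 Then, for every integer $n \geq 1$, $W_n\mathcal{O}_X(D)$ is a coherent $W_n\mathcal{O}_X$-module, i.e. it is of finite type, and for every open subset $U \subseteq X$ and all finitely many sections $s_1, \ldots, s_k \in \Gamma(U, W_n\mathcal{O}_X(D))$ the kernel of $(W_n\mathcal{O}_X|_U)^{k} \to W_n\mathcal{O}_X(D)|_U$, $(a_1, \ldots, a_k) \mapsto \sum_i a_i s_i$, is a $W_n\mathcal{O}_X|_U$-module of finite type. -/

import Mathlib

open CategoryTheory AlgebraicGeometry TopologicalSpace

universe u

namespace WittDivisorial

section Algebra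

variable (p : ℕ) [Fact p.Prime]

theorem teichmuller_mul_of_invertible {R : Type*} [CommRing R] [Invertible (p : R)]
    (r : R) (x : WittVector p R) :
    WittVector.teichmuller p r * x = WittVector.mk p fun n => r ^ p ^ n * x.coeff n := by
  apply (WittVector.ghostMap.bijective_of_invertible p R).1
  funext n
  rw [map_mul, Pi.mul_apply]
  simp only [WittVector.ghostMap_apply, WittVector.ghostComponent_apply,
    aeval_wittPolynomial, WittVector.coeff_mk]
  have h := WittVector.ghostComponent_teichmuller p r n
  rw [WittVector.ghostComponent_apply, aeval_wittPolynomial] at h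
  rw [h, Finset.mul_sum]
  refine Finset.sum_congr rfl fun i hi => ?_
  have : r ^ p ^ n = (r ^ p ^ i) ^ p ^ (n - i) := by
    rw [← pow_mul, ← pow_add, Nat.add_sub_cancel' (Finset.mem_range_succ_iff.mp hi)]
  rw [mul_pow, this]
  ring

/-- `[r] (x₀, x₁, x₂, …) = (r x₀, r^p x₁, r^(p^2) x₂, …)` for Witt vectors over any ring. -/
theorem teichmuller_mul {R : Type*} [CommRing R] (r : R) (x : WittVector p R) :
    WittVector.teichmuller p r * x = WittVector.mk p fun n => r ^ p ^ n * x.coeff n := by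
  have key : ∀ (r : MvPolynomial R ℤ) (x : WittVector p (MvPolynomial R ℤ)),
      WittVector.teichmuller p r * x = WittVector.mk p fun n => r ^ p ^ n * x.coeff n := by
    intro r x
    apply WittVector.map_injective (MvPolynomial.map (Int.castRingHom ℚ))
      (MvPolynomial.map_injective _ Int.cast_injective)
    rw [map_mul, WittVector.map_teichmuller, teichmuller_mul_of_invertible]
    ext n
    simp [WittVector.map_coeff]
  obtain ⟨r', rfl⟩ := MvPolynomial.counit_surjective R r
  obtain ⟨x', rfl⟩ := WittVector.map_surjective (MvPolynomial.counit R)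
    (MvPolynomial.counit_surjective R) x
  rw [← WittVector.map_teichmuller, ← map_mul, key]
  ext n
  simp [WittVector.map_coeff]

/-- For a multiplicative family of subgroups `G i` of a ring `K`, the polynomials whose `i`-th
coefficient lies in `G i` for all `i`. -/
def reesSubring {K : Type*} [CommRing K] (G : ℕ → AddSubgroup K) (one_mem : (1 : K) ∈ G 0)
    (mul_mem : ∀ i j a b, a ∈ G i → b ∈ G j → a * b ∈ G (i + j)) :
    Subring (Polynomial K) where
  carrier := {f | ∀ i, f.coeff i ∈ G i}
  mul_mem' {f g} hf hg i := by
    rw [Polynomial.coeff_mul]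
    refine sum_mem fun x hx => ?_
    rw [← (Finset.HasAntidiagonal.mem_antidiagonal.mp hx : x.1 + x.2 = i)]
    exact mul_mem _ _ _ _ (hf _) (hg _)
  one_mem' i := by
    rw [Polynomial.coeff_one]
    split_ifs with h
    · rw [h]; exact one_mem
    · exact zero_mem _
  add_mem' {f g} hf hg i := by
    rw [Polynomial.coeff_add]
    exact add_mem (hf i) (hg i)
  zero_mem' i := by
    rw [Polynomial.coeff_zero]
    exact zero_mem _
  neg_mem' {f} hf i := by
    rw [Polynomial.coeff_neg]
    exact neg_mem (hf i)

theorem exists_lift_rees {K : Type*} [CommRing K] (G : ℕ → AddSubgroup K)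
    (one_mem : (1 : K) ∈ G 0) (mul_mem : ∀ i j a b, a ∈ G i → b ∈ G j → a * b ∈ G (i + j))
    {x : WittVector p K} (hx : ∀ m, x.coeff m ∈ G (p ^ m)) :
    ∃ z, WittVector.map (reesSubring G one_mem mul_mem).subtype z =
      WittVector.teichmuller p Polynomial.X * WittVector.map Polynomial.C x := by
  refine ⟨WittVector.mk p fun m => ⟨Polynomial.X ^ p ^ m * Polynomial.C (x.coeff m),
    fun i => ?_⟩, ?_⟩
  · rw [Polynomial.coeff_X_pow_mul', Polynomial.coeff_C]
    split_ifs with h h'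
    · rw [show i = p ^ m by omega]; exact hx m
    · exact zero_mem _
    · exact zero_mem _
  · rw [teichmuller_mul]
    ext m : 1
    simp [WittVector.map_coeff]

theorem exists_lift_rees' {K : Type*} [CommRing K] (G : ℕ → AddSubgroup K)
    (one_mem : (1 : K) ∈ G 0) (mul_mem : ∀ i j a b, a ∈ G i → b ∈ G j → a * b ∈ G (i + j))
    {x : WittVector p K} (hx : ∀ m, x.coeff m ∈ G 0) :
    ∃ z, WittVector.map (reesSubring G one_mem mul_mem).subtype z =
      WittVector.map Polynomial.C x := by
  refine ⟨WittVector.mk p fun m => ⟨Polynomial.C (x.coeff m), fun i => ?_⟩, ?_⟩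
  · rw [Polynomial.coeff_C]
    split_ifs with h
    · rw [h]; exact hx m
    · exact zero_mem _
  · ext m : 1
    simp [WittVector.map_coeff]

theorem coeff_mem_of_lift {K : Type*} [CommRing K] (G : ℕ → AddSubgroup K)
    (one_mem : (1 : K) ∈ G 0) (mul_mem : ∀ i j a b, a ∈ G i → b ∈ G j → a * b ∈ G (i + j))
    {x : WittVector p K}
    (hx : ∃ z, WittVector.map (reesSubring G one_mem mul_mem).subtype z =
      WittVector.teichmuller p Polynomial.X * WittVector.map Polynomial.C x) (m : ℕ) :
    x.coeff m ∈ G (p ^ m) := by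
  obtain ⟨z, hz⟩ := hx
  have h := congrArg (fun w => w.coeff m) hz
  simp only [teichmuller_mul, WittVector.map_coeff, WittVector.coeff_mk] at h
  have h2 := (z.coeff m).2 (p ^ m)
  rw [Subring.subtype_apply] at h
  rw [h, Polynomial.coeff_X_pow_mul', Polynomial.coeff_C] at h2
  simpa using h2

theorem truncated_add_mem {n : ℕ} {K : Type*} [CommRing K] (G : ℕ → AddSubgroup K)
    (one_mem : (1 : K) ∈ G 0) (mul_mem : ∀ i j a b, a ∈ G i → b ∈ G j → a * b ∈ G (i + j))
    {x y : TruncatedWittVector p n K}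
    (hx : ∀ i : Fin n, x.coeff i ∈ G (p ^ (i : ℕ)))
    (hy : ∀ i : Fin n, y.coeff i ∈ G (p ^ (i : ℕ))) (i : Fin n) :
    (x + y).coeff i ∈ G (p ^ (i : ℕ)) := by
  have hout : ∀ {x : TruncatedWittVector p n K}, (∀ i : Fin n, x.coeff i ∈ G (p ^ (i : ℕ))) →
      ∀ m, x.out.coeff m ∈ G (p ^ m) := by
    intro x hx m
    simp only [TruncatedWittVector.out]
    split_ifs with h
    · exact hx ⟨m, h⟩
    · exact zero_mem _
  have hxy : x + y = WittVector.truncateFun n (x.out + y.out) := by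
    rw [WittVector.truncateFun_add, TruncatedWittVector.truncateFun_out,
      TruncatedWittVector.truncateFun_out]
  rw [hxy, WittVector.coeff_truncateFun]
  obtain ⟨z, hz⟩ := exists_lift_rees p G one_mem mul_mem (hout hx)
  obtain ⟨w, hw⟩ := exists_lift_rees p G one_mem mul_mem (hout hy)
  exact coeff_mem_of_lift p G one_mem mul_mem
    ⟨z + w, by rw [map_add, hz, hw, map_add, mul_add]⟩ _

theorem truncated_mul_mem {n : ℕ} {K : Type*} [CommRing K] (G : ℕ → AddSubgroup K)
    (one_mem : (1 : K) ∈ G 0) (mul_mem : ∀ i j a b, a ∈ G i → b ∈ G j → a * b ∈ G (i + j))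
    {a x : TruncatedWittVector p n K}
    (ha : ∀ i : Fin n, a.coeff i ∈ G 0)
    (hx : ∀ i : Fin n, x.coeff i ∈ G (p ^ (i : ℕ))) (i : Fin n) :
    (a * x).coeff i ∈ G (p ^ (i : ℕ)) := by
  have hout : ∀ m, x.out.coeff m ∈ G (p ^ m) := by
    intro m
    simp only [TruncatedWittVector.out]
    split_ifs with h
    · exact hx ⟨m, h⟩
    · exact zero_mem _
  have hout' : ∀ m, a.out.coeff m ∈ G 0 := by
    intro m
    simp only [TruncatedWittVector.out]
    split_ifs with h
    · exact ha ⟨m, h⟩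
    · exact zero_mem _
  have hax : a * x = WittVector.truncateFun n (a.out * x.out) := by
    rw [WittVector.truncateFun_mul, TruncatedWittVector.truncateFun_out,
      TruncatedWittVector.truncateFun_out]
  rw [hax, WittVector.coeff_truncateFun]
  obtain ⟨z, hz⟩ := exists_lift_rees p G one_mem mul_mem hout
  obtain ⟨w, hw⟩ := exists_lift_rees' p G one_mem mul_mem hout'
  exact coeff_mem_of_lift p G one_mem mul_mem
    ⟨w * z, by rw [map_mul, hz, hw, map_mul]; ring⟩ _

/-- The ring homomorphism `W_n(R) → W_n(S)`, `(a₀, …, a_{n-1}) ↦ (f a₀, …, f a_{n-1})`. -/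
def truncatedMap (n : ℕ) {R S : Type*} [CommRing R] [CommRing S] (f : R →+* S) :
    TruncatedWittVector p n R →+* TruncatedWittVector p n S :=
  have comm : ∀ x : WittVector p R, WittVector.truncate n (WittVector.map f x) =
      TruncatedWittVector.mk p fun i => f ((WittVector.truncate n x).coeff i) := by
    intro x
    ext i
    simp [WittVector.coeff_truncate, WittVector.map_coeff]
  { toFun := fun x => TruncatedWittVector.mk p fun i => f (x.coeff i)
    map_one' := by
      have := comm 1
      rw [map_one, map_one, map_one] at this
      exact this.symm
    map_zero' := by
      have := comm 0
      rw [map_zero, map_zero, map_zero] at this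
      exact this.symm
    map_mul' := fun x y => by
      obtain ⟨x, rfl⟩ := WittVector.truncate_surjective p n R x
      obtain ⟨y, rfl⟩ := WittVector.truncate_surjective p n R y
      rw [← map_mul, ← comm, ← comm, ← comm, map_mul, map_mul]
    map_add' := fun x y => by
      obtain ⟨x, rfl⟩ := WittVector.truncate_surjective p n R x
      obtain ⟨y, rfl⟩ := WittVector.truncate_surjective p n R y
      rw [← map_add, ← comm, ← comm, ← comm, map_add, map_add] }

@[simp]
theorem truncatedMap_coeff (n : ℕ) {R S : Type*} [CommRing R] [CommRing S] (f : R →+* S)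
    (x : TruncatedWittVector p n R) (i : Fin n) :
    (truncatedMap p n f x).coeff i = f (x.coeff i) :=
  TruncatedWittVector.coeff_mk _ _

end Algebra

noncomputable section

section Coherent

/-! Coherent modules on a ringed space, i.e. a topological space with a sheaf of rings `R`. -/

variable {X : TopCat.{u}} {R : TopCat.Sheaf RingCat.{u} X} (M : SheafOfModules.{u} R)

/-- Restriction of sections of the sheaf of rings `R`. -/
def ringRes {U V : Opens X} (h : V ≤ U) (a : R.obj.obj (Opposite.op U)) :
    R.obj.obj (Opposite.op V) :=
  R.obj.map (homOfLE h).op a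

/-- Restriction of sections of the sheaf of modules `M`. -/
def moduleRes {U V : Opens X} (h : V ≤ U) (s : M.val.obj (Opposite.op U)) :
    M.val.obj (Opposite.op V) :=
  M.val.map (homOfLE h).op s

/-- `M` is of finite type: every point has an open neighbourhood `U` with finitely many sections
`s₁, …, s_k ∈ M(U)` that generate `M|_U`, i.e. every local section of `M|_U` is locally an
`R`-linear combination of the restrictions of `s₁, …, s_k`. -/
def IsOfFiniteType : Prop :=
  ∀ x : X, ∃ U : Opens X, x ∈ U ∧ ∃ (k : ℕ) (s : Fin k → M.val.obj (Opposite.op U)),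
    ∀ (V : Opens X) (hV : V ≤ U) (m : M.val.obj (Opposite.op V)), ∀ y ∈ V,
      ∃ (W : Opens X) (hW : W ≤ V), y ∈ W ∧
        moduleRes M hW m ∈ Submodule.span (R.obj.obj (Opposite.op W))
          (Set.range fun i => moduleRes M (hW.trans hV) (s i))

/-- For sections `s₁, …, s_k ∈ M(U)` and `V ⊆ U`, the sections over `V` of the kernel of
`R^k|_U → M|_U`, `(a₁, …, a_k) ↦ ∑ a_i s_i`. -/
def relations {U : Opens X} {k : ℕ} (s : Fin k → M.val.obj (Opposite.op U)) {V : Opens X}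
    (hV : V ≤ U) : Set (Fin k → R.obj.obj (Opposite.op V)) :=
  {a | ∑ i, a i • moduleRes M hV (s i) = 0}

/-- For sections `s₁, …, s_k ∈ M(U)`, the kernel of `R^k|_U → M|_U`, `(a_i) ↦ ∑ a_i s_i`, is of
finite type. -/
def RelationsOfFiniteType {U : Opens X} {k : ℕ} (s : Fin k → M.val.obj (Opposite.op U)) : Prop :=
  ∀ x ∈ U, ∃ (V : Opens X) (hV : V ≤ U), x ∈ V ∧
    ∃ (l : ℕ) (r : Fin l → Fin k → R.obj.obj (Opposite.op V)), (∀ j, r j ∈ relations M s hV) ∧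
      ∀ (V' : Opens X) (hV' : V' ≤ V), ∀ a ∈ relations M s (hV'.trans hV), ∀ y ∈ V',
        ∃ (W : Opens X) (hW : W ≤ V'), y ∈ W ∧
          (fun i => ringRes hW (a i)) ∈ Submodule.span (R.obj.obj (Opposite.op W))
            (Set.range fun (j : Fin l) (i : Fin k) => ringRes (hW.trans hV') (r j i))

/-- `M` is a coherent `R`-module: it is of finite type, and for every open `U` and all finitely
many sections `s₁, …, s_k ∈ M(U)` the kernel of `R^k|_U → M|_U` is of finite type. -/
structure IsCoherent : Prop where
  isOfFiniteType : IsOfFiniteType M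
  relationsOfFiniteType : ∀ (U : Opens X) (k : ℕ) (s : Fin k → M.val.obj (Opposite.op U)),
    RelationsOfFiniteType M s

end Coherent

section Scheme

variable (p : ℕ) [Fact p.Prime] (n : ℕ) (X : Scheme.{u})

/-- The functor `W_n` of truncated `p`-typical Witt vectors on commutative rings. -/
def wittFunctor : CommRingCat.{u} ⥤ CommRingCat.{u} where
  obj R := CommRingCat.of (TruncatedWittVector p n R)
  map f := CommRingCat.ofHom (truncatedMap p n f.hom)
  map_id R := by
    refine CommRingCat.hom_ext (RingHom.ext fun x => TruncatedWittVector.ext (p := p) fun i => ?_)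
    exact truncatedMap_coeff p n _ x i
  map_comp f g := by
    refine CommRingCat.hom_ext (RingHom.ext fun x => TruncatedWittVector.ext (p := p) fun i => ?_)
    change (truncatedMap p n (f ≫ g).hom x).coeff i =
      (truncatedMap p n g.hom (truncatedMap p n f.hom x)).coeff i
    simp

theorem wittPresheaf_isSheaf : TopCat.Presheaf.IsSheaf (X.presheaf ⋙ wittFunctor p n) := by
  rw [TopCat.Presheaf.isSheaf_iff_isSheafUniqueGluing]
  intro ι U sf hsf
  have hco : ∀ k : Fin n, TopCat.Presheaf.IsCompatible X.presheaf U
      (fun i => TruncatedWittVector.coeff (p := p) (R := Γ(X, U i)) k (sf i)) := by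
    intro k i j
    have := congrArg (TruncatedWittVector.coeff (p := p) k) (hsf i j)
    exact (truncatedMap_coeff p n _ _ k).symm.trans
      (this.trans (truncatedMap_coeff p n _ _ k))
  choose s hs hu using fun k => X.sheaf.existsUnique_gluing U _ (hco k)
  refine ⟨TruncatedWittVector.mk p s, fun i => ?_, fun t ht => ?_⟩
  · refine TruncatedWittVector.ext (p := p) fun k => ?_
    refine (truncatedMap_coeff p n _ _ k).trans ?_
    exact (congrArg _ (TruncatedWittVector.coeff_mk (p := p) s k)).trans (hs k i)
  · refine TruncatedWittVector.ext (p := p) fun k => ?_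
    refine Eq.trans ?_ (TruncatedWittVector.coeff_mk (p := p) s k).symm
    refine hu k _ fun i => ?_
    exact (truncatedMap_coeff p n _ _ k).symm.trans (congrArg (TruncatedWittVector.coeff (p := p) k) (ht i))

/-- The sheaf of commutative rings `W_n 𝒪_X`, `U ↦ W_n(Γ(U, 𝒪_X))`. -/
def wittSheaf : TopCat.Sheaf CommRingCat.{u} X :=
  ⟨X.presheaf ⋙ wittFunctor p n, wittPresheaf_isSheaf p n X⟩

/-- `W_n 𝒪_X` as a sheaf of rings. -/
def wittRingSheaf : TopCat.Sheaf RingCat.{u} X :=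
  (sheafCompose _ (forget₂ CommRingCat.{u} RingCat.{u})).obj (wittSheaf p n X)

/-- A scheme all of whose local rings are integrally closed domains. -/
class IsNormalScheme : Prop where
  isDomain_stalk (x : X) : IsDomain (X.presheaf.stalk x)
  isIntegrallyClosed_stalk (x : X) : IsIntegrallyClosed (X.presheaf.stalk x)

/-- A prime divisor, represented by its generic point, a point of codimension one. -/
abbrev PrimeDivisor : Type u := {x : X // Order.coheight x = 1}

/-- An `ℝ`-divisor: a finite formal `ℝ`-linear combination of prime divisors. -/
abbrev RDivisor : Type u := PrimeDivisor X →₀ ℝ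

section Frobenius

/-- `X` is an `𝔽_p`-scheme. -/
class IsFpScheme : Prop where
  nonempty_hom : Nonempty (X ⟶ Spec (CommRingCat.of (ULift.{u} (ZMod p))))

theorem natCast_eq_zero [IsFpScheme p X] (U : X.Opens) : (p : Γ(X, U)) = 0 := by
  obtain ⟨f⟩ := IsFpScheme.nonempty_hom (p := p) (X := X)
  let g : ULift.{u} (ZMod p) →+* Γ(X, U) :=
    (X.presheaf.map (homOfLE le_top : U ⟶ ⊤).op).hom.comp
      (f.appTop.hom.comp (Scheme.ΓSpecIso (CommRingCat.of (ULift.{u} (ZMod p)))).inv.hom)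
  have h : (p : ULift.{u} (ZMod p)) = 0 := by
    ext
    simp
  rw [← map_natCast g, h, map_zero]

/-- The `p`-power map as an endomorphism of a commutative ring in which `p = 0`. -/
def powHom {R : Type*} [CommRing R] (h : (p : R) = 0) : R →+* R where
  toFun a := a ^ p
  map_one' := one_pow p
  map_zero' := zero_pow (Fact.out : p.Prime).ne_zero
  map_mul' a b := mul_pow a b p
  map_add' a b := by
    obtain ⟨r, hr⟩ := exists_add_pow_prime_eq (Fact.out : p.Prime) a b
    rw [hr, h]
    ring

/-- The absolute Frobenius endomorphism of an `𝔽_p`-scheme: the identity on the underlying space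
and `a ↦ a ^ p` on sections. -/
def absFrobenius [IsFpScheme p X] : X ⟶ X where
  base := 𝟙 _
  c := { app := fun U => CommRingCat.ofHom (powHom p (natCast_eq_zero p X U.unop))
         naturality := fun U V i => by
          ext a
          exact map_pow (X.presheaf.map i).hom a p |>.symm }
  prop x := by
    constructor
    intro a ha
    obtain ⟨U, hx, b, rfl⟩ := X.presheaf.exists_germ_eq a
    erw [PresheafedSpace.stalkMap_germ_apply] at ha
    have h : X.presheaf.germ U x hx (b ^ p) = X.presheaf.germ U x hx b ^ p := map_pow _ _ _
    change IsUnit (X.presheaf.germ U x hx (b ^ p)) at ha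
    rw [h] at ha
    exact (isUnit_pow_iff (Fact.out : p.Prime).ne_zero).mp ha

/-- `X` is `F`-finite: its absolute Frobenius morphism is finite. -/
class IsFFinite [IsFpScheme p X] : Prop where
  isFinite_absFrobenius : IsFinite (absFrobenius p X)

end Frobenius

section Divisorial

variable {X} [IsIntegral X] [IsLocallyNoetherian X]

/-- `(div(φ) + D)|_U ≥ 0`, that is, `φ` is a section of `𝒪_X(D)` over `U`. -/
def DivAddNonneg (D : RDivisor X) (U : X.Opens) (φ : X.functionField) : Prop :=
  φ ≠ 0 → ∀ P : PrimeDivisor X, P.1 ∈ U → 0 ≤ (X.ord φ P.1 : ℝ) + D P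

theorem isDVR_stalk [IsNormalScheme X] (P : PrimeDivisor X) :
    IsDiscreteValuationRing (X.presheaf.stalk P.1) := by
  have := IsNormalScheme.isIntegrallyClosed_stalk (X := X) P.1
  have : Ring.KrullDimLE 1 (X.presheaf.stalk P.1) := krullDimLE_of_coheight_le P.2.le
  have hf : ¬ IsField (X.presheaf.stalk P.1) := by
    intro h
    have h1 := ringKrullDim_eq_zero_of_isField h
    rw [ringKrullDim_stalk_eq_coheight, P.2] at h1
    exact one_ne_zero h1
  have : IsDedekindDomain (X.presheaf.stalk P.1) :=
    { maximalOfPrime := fun {I} hI hI' =>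
        Ring.krullDimLE_one_iff_of_noZeroDivisors.mp inferInstance I hI hI' }
  exact ((IsDiscreteValuationRing.TFAE _ hf).out 0 2).mpr this

/-- The sections of `𝒪_X(D)` over a nonempty open set `U`, as a subgroup of the function field. -/
def divisorSections [IsNormalScheme X] (D : RDivisor X) (U : X.Opens) :
    AddSubgroup X.functionField where
  carrier := {φ | DivAddNonneg D U φ}
  add_mem' {φ ψ} hφ hψ h P hP := by
    have := isDVR_stalk P
    by_cases h1 : φ = 0
    · subst h1; rw [zero_add] at h ⊢; exact hψ h P hP
    by_cases h2 : ψ = 0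
    · subst h2; rw [add_zero] at h ⊢; exact hφ h P hP
    have h3 := hφ h1 P hP
    have h4 := hψ h2 P hP
    have h5 := Scheme.ord_add (x := P.1) h
    rcases min_le_iff.mp h5 with h6 | h6
    · have : ((X.ord φ P.1 : ℤ) : ℝ) ≤ X.ord (φ + ψ) P.1 := by exact_mod_cast h6
      linarith
    · have : ((X.ord ψ P.1 : ℤ) : ℝ) ≤ X.ord (φ + ψ) P.1 := by exact_mod_cast h6
      linarith
  zero_mem' h := absurd rfl h
  neg_mem' {φ} hφ h P hP := by
    have h0 : φ ≠ 0 := neg_ne_zero.mp h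
    have h1 : X.ord (-1 * -1 : X.functionField) P.1 = X.ord (-1 * -1 * (-1 * -1)) P.1 := by simp
    have hne : (-1 : X.functionField) ≠ 0 := neg_ne_zero.mpr one_ne_zero
    rw [Scheme.ord_mul (mul_ne_zero hne hne) (mul_ne_zero hne hne),
      Scheme.ord_mul hne hne] at h1
    have h2 : X.ord (-φ) P.1 = X.ord φ P.1 := by
      rw [← neg_one_mul, Scheme.ord_mul hne h0]
      omega
    rw [h2]
    exact hφ h0 P hP

theorem mem_divisorSections [IsNormalScheme X] {D : RDivisor X} {U : X.Opens}
    {φ : X.functionField} : φ ∈ divisorSections D U ↔ DivAddNonneg D U φ :=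
  Iff.rfl

theorem one_mem_divisorSections [IsNormalScheme X] (D : RDivisor X) (U : X.Opens) :
    (1 : X.functionField) ∈ divisorSections ((0 : ℝ) • D) U := by
  intro _ P hP
  have h1 : X.ord (1 * 1 : X.functionField) P.1 = X.ord 1 P.1 := by simp
  rw [Scheme.ord_mul one_ne_zero one_ne_zero] at h1
  have h2 : X.ord (1 : X.functionField) P.1 = 0 := by omega
  simp [h2]

theorem mul_mem_divisorSections [IsNormalScheme X] {D E F : RDivisor X} (hF : D + E = F)
    {U : X.Opens} {φ ψ : X.functionField} (hφ : φ ∈ divisorSections D U)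
    (hψ : ψ ∈ divisorSections E U) : φ * ψ ∈ divisorSections F U := by
  subst hF
  intro h P hP
  have h1 := hφ (left_ne_zero_of_mul h) P hP
  have h2 := hψ (right_ne_zero_of_mul h) P hP
  rw [Scheme.ord_mul (left_ne_zero_of_mul h) (right_ne_zero_of_mul h), Finsupp.add_apply]
  push_cast
  linarith

theorem germ_mem_divisorSections [IsNormalScheme X] (U : X.Opens) [Nonempty U] (a : Γ(X, U)) :
    X.germToFunctionField U a ∈ divisorSections 0 U := by
  intro h P hP
  have ha : a ≠ 0 := by
    rintro rfl
    exact h (map_zero _)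
  have h1 := Scheme.ord_le_smul hP ha (1 : X.functionField)
  have h2 : X.ord (1 * 1 : X.functionField) P.1 = X.ord 1 P.1 := by simp
  rw [Scheme.ord_mul one_ne_zero one_ne_zero] at h2
  rw [Algebra.smul_def, mul_one, RingHom.algebraMap_toAlgebra] at h1
  have h3 : (0 : ℤ) ≤ X.ord (X.germToFunctionField U a) P.1 := by
    have : X.ord (1 : X.functionField) P.1 = 0 := by omega
    rw [this] at h1
    exact h1
  simpa using h3

/-- The ring homomorphism from `W_n(Γ(U, 𝒪_X))` to the sections over `U` of the constant sheaf
`W_n(K(X))`, that is, the locally constant functions `U → W_n(K(X))`. -/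
def toConstant (U : X.Opens) :
    TruncatedWittVector p n Γ(X, U) →+*
      LocallyConstant U (TruncatedWittVector p n X.functionField) where
  toFun a :=
    { toFun := fun x =>
        haveI : Nonempty U := ⟨x⟩
        truncatedMap p n (X.germToFunctionField U).hom a
      isLocallyConstant := IsLocallyConstant.of_constant _ fun _ _ => rfl }
  map_one' := LocallyConstant.ext fun x =>
    haveI : Nonempty U := ⟨x⟩
    map_one (truncatedMap p n (X.germToFunctionField U).hom)
  map_zero' := LocallyConstant.ext fun x =>
    haveI : Nonempty U := ⟨x⟩
    map_zero (truncatedMap p n (X.germToFunctionField U).hom)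
  map_mul' a b := LocallyConstant.ext fun x =>
    haveI : Nonempty U := ⟨x⟩
    map_mul (truncatedMap p n (X.germToFunctionField U).hom) a b
  map_add' a b := LocallyConstant.ext fun x =>
    haveI : Nonempty U := ⟨x⟩
    map_add (truncatedMap p n (X.germToFunctionField U).hom) a b

theorem toConstant_coeff (U : X.Opens) (a : TruncatedWittVector p n Γ(X, U)) (x : U)
    (i : Fin n) :
    haveI : Nonempty U := ⟨x⟩
    (toConstant p n U a x).coeff i = X.germToFunctionField U (a.coeff i) :=
  truncatedMap_coeff p n _ a i

instance constantModule (U : X.Opens) : Module (TruncatedWittVector p n Γ(X, U))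
    (LocallyConstant U (TruncatedWittVector p n X.functionField)) :=
  Module.compHom _ (toConstant p n U)

/-- `Γ(U, W_n 𝒪_X(D))`: the sections `(φ₀, …, φ_{n-1})` over `U` of the constant sheaf `W_n(K(X))`
such that `(div(φ_i) + p^i D)|_U ≥ 0` for all `i`. -/
def wittDivisorialSections [IsNormalScheme X] (D : RDivisor X) (U : X.Opens) :
    Submodule (TruncatedWittVector p n Γ(X, U))
      (LocallyConstant U (TruncatedWittVector p n X.functionField)) where
  carrier := {s | ∀ (x : U) (i : Fin n), DivAddNonneg ((p : ℝ) ^ (i : ℕ) • D) U ((s x).coeff i)}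
  add_mem' {s t} hs ht x i := by
    have := truncated_add_mem p (n := n) (fun j => divisorSections ((j : ℝ) • D) U)
      (by simpa using one_mem_divisorSections D U)
      (fun i j a b ha hb => mul_mem_divisorSections (by push_cast; rw [add_smul]) ha hb)
      (x := s x) (y := t x)
      (fun i => by simpa [mem_divisorSections] using hs x i)
      (fun i => by simpa [mem_divisorSections] using ht x i) i
    simp only [mem_divisorSections, Nat.cast_pow] at this
    exact this
  zero_mem' x i h := absurd (TruncatedWittVector.coeff_zero p n X.functionField i) h
  smul_mem' a s hs x i := by
    have : Nonempty U := ⟨x⟩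
    have := truncated_mul_mem p (n := n) (fun j => divisorSections ((j : ℝ) • D) U)
      (by simpa using one_mem_divisorSections D U)
      (fun i j a b ha hb => mul_mem_divisorSections (by push_cast; rw [add_smul]) ha hb)
      (a := toConstant p n U a x) (x := s x)
      (fun i => by
        rw [toConstant_coeff]
        simpa using germ_mem_divisorSections U (a.coeff i))
      (fun i => by simpa [mem_divisorSections] using hs x i) i
    simp only [mem_divisorSections, Nat.cast_pow] at this
    exact this

theorem mem_wittDivisorialSections [IsNormalScheme X] {D : RDivisor X} {U : X.Opens}
    {s : LocallyConstant U (TruncatedWittVector p n X.functionField)} :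
    s ∈ wittDivisorialSections p n D U ↔
      ∀ (x : U) (i : Fin n), DivAddNonneg ((p : ℝ) ^ (i : ℕ) • D) U ((s x).coeff i) :=
  Iff.rfl

/-- Restriction of sections of `W_n 𝒪_X(D)` to a smaller open set. -/
def wittDivisorialRes [IsNormalScheme X] (D : RDivisor X) {U V : X.Opens} (h : V ≤ U) :
    wittDivisorialSections p n D U →+ wittDivisorialSections p n D V where
  toFun s := ⟨s.1.comap ⟨Set.inclusion h, continuous_inclusion h⟩,
    fun x i hne P hP => s.2 (Set.inclusion h x) i hne P (h hP)⟩
  map_zero' := rfl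
  map_add' _ _ := rfl

/-- The presheaf of abelian groups underlying `W_n 𝒪_X(D)`. -/
def wittDivisorialPresheaf [IsNormalScheme X] (D : RDivisor X) :
    TopCat.Presheaf AddCommGrpCat.{u} X where
  obj U := AddCommGrpCat.of (wittDivisorialSections p n D U.unop)
  map i := AddCommGrpCat.ofHom (wittDivisorialRes p n D i.unop.le)
  map_id _ := rfl
  map_comp _ _ := rfl

instance wittDivisorialModule [IsNormalScheme X] (D : RDivisor X) (U : (Opens X)ᵒᵖ) :
    Module ((wittRingSheaf p n X).obj.obj U) ((wittDivisorialPresheaf p n D).obj U) :=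
  inferInstanceAs (Module (TruncatedWittVector p n Γ(X, U.unop))
    (wittDivisorialSections p n D U.unop))

theorem wittDivisorialPresheaf_isSheaf [IsNormalScheme X] (D : RDivisor X) :
    TopCat.Presheaf.IsSheaf (wittDivisorialPresheaf p n D) := by
  rw [TopCat.Presheaf.isSheaf_iff_isSheafUniqueGluing]
  intro ι U sf hsf
  let t : ∀ i, LocallyConstant (U i) (TruncatedWittVector p n X.functionField) :=
    fun i => (sf i : wittDivisorialSections p n D (U i)).1
  have ht : ∀ i j (x : X) (hi : x ∈ U i) (hj : x ∈ U j), t i ⟨x, hi⟩ = t j ⟨x, hj⟩ := by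
    intro i j x hi hj
    have h : wittDivisorialRes p n D (inf_le_left : U i ⊓ U j ≤ U i) (sf i) =
        wittDivisorialRes p n D (inf_le_right : U i ⊓ U j ≤ U j) (sf j) := hsf i j
    exact DFunLike.congr_fun (congrArg Subtype.val h) (⟨x, hi, hj⟩ : (U i ⊓ U j : X.Opens))
  choose k hk using fun x : (iSup U : X.Opens) => Opens.mem_iSup.mp x.2
  let s : LocallyConstant (iSup U : X.Opens) (TruncatedWittVector p n X.functionField) :=
    { toFun := fun x => t (k x) ⟨x.1, hk x⟩
      isLocallyConstant := by
        rw [IsLocallyConstant.iff_exists_open]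
        intro x
        obtain ⟨W, hW, hxW, hc⟩ := (IsLocallyConstant.iff_exists_open _).mp
          (t (k x)).isLocallyConstant ⟨x.1, hk x⟩
        obtain ⟨W', hW', rfl⟩ := isOpen_induced_iff.mp hW
        refine ⟨Subtype.val ⁻¹' (W' ∩ U (k x)),
          (hW'.inter (U (k x)).isOpen).preimage continuous_subtype_val, ⟨hxW, hk x⟩, ?_⟩
        rintro y ⟨hy, hy'⟩
        exact (ht (k y) (k x) y.1 (hk y) hy').trans (hc ⟨y.1, hy'⟩ hy) }
  have hs : ∀ i (x : X) (hx : x ∈ U i), s ⟨x, Opens.mem_iSup.mpr ⟨i, hx⟩⟩ = t i ⟨x, hx⟩ :=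
    fun i x hx => ht (k ⟨x, Opens.mem_iSup.mpr ⟨i, hx⟩⟩) i x _ hx
  have : PreconnectedSpace (iSup U : X.Opens) := Subtype.preconnectedSpace
    ((PreirreducibleSpace.isPreirreducible_univ.open_subset (iSup U).isOpen
      (Set.subset_univ _)).isPreconnected)
  have hmem : s ∈ wittDivisorialSections p n D (iSup U) := by
    intro x m hne P hP
    obtain ⟨i, hi⟩ := Opens.mem_iSup.mp hP
    have h := s.isLocallyConstant.apply_eq_of_preconnectedSpace x ⟨P.1, hP⟩
    have h' : s x = t i ⟨P.1, hi⟩ := h.trans (hs i P.1 hi)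
    rw [h'] at hne ⊢
    exact (sf i : wittDivisorialSections p n D (U i)).2 ⟨P.1, hi⟩ m hne P hi
  refine ⟨(⟨s, hmem⟩ : wittDivisorialSections p n D (iSup U)), fun i => ?_, fun s' hs' => ?_⟩
  · exact Subtype.ext (LocallyConstant.ext fun x => hs i x.1 x.2)
  · refine Subtype.ext (LocallyConstant.ext fun x => ?_)
    obtain ⟨i, hi⟩ := Opens.mem_iSup.mp x.2
    have h1 : wittDivisorialRes p n D (Opens.leSupr U i).le s' = sf i := hs' i
    have h2 := DFunLike.congr_fun (congrArg Subtype.val h1) (⟨x.1, hi⟩ : U i)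
    exact h2.trans (hs i x.1 hi).symm

/-- The Witt divisorial sheaf `W_n 𝒪_X(D)`, a sheaf of modules over `W_n 𝒪_X`. -/
def wittDivisorialSheaf [IsNormalScheme X] (D : RDivisor X) :
    SheafOfModules.{u} (wittRingSheaf p n X) where
  val := PresheafOfModules.ofPresheaf (wittDivisorialPresheaf p n D) (by
    intro U V i a s
    have h : ∀ {U V : X.Opens} (h : V ≤ U) (a : TruncatedWittVector p n Γ(X, U))
        (s : wittDivisorialSections p n D U), wittDivisorialRes p n D h (a • s) =
          (truncatedMap p n (X.presheaf.map (homOfLE h).op).hom a) •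
            wittDivisorialRes p n D h s := by
      intro U V h a s
      refine Subtype.ext (LocallyConstant.ext fun x => ?_)
      have : toConstant p n U a (Set.inclusion h x) =
          toConstant p n V (truncatedMap p n (X.presheaf.map (homOfLE h).op).hom a) x := by
        refine TruncatedWittVector.ext fun i => ?_
        refine (toConstant_coeff p n U a _ i).trans ?_
        refine Eq.trans ?_ (toConstant_coeff p n V _ x i).symm
        rw [truncatedMap_coeff]
        exact (X.presheaf.germ_res_apply (homOfLE h) _ _ _).symm
      exact congrArg (· * s.1 (Set.inclusion h x)) this
    exact h i.unop.le a s)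
  isSheaf := wittDivisorialPresheaf_isSheaf p n D

end Divisorial

end Scheme

end

end WittDivisorial

/-! Let `U` be a nonempty affine open set, `A` its ring of sections and `K` the function field. An
open subset of an integral scheme is connected, so evaluation at the generic point embeds the
sections `M` over `U` into `W_n(K)`.

Filter `M` by the number of leading zero coefficients. The `j`-th graded piece embeds by its `j`-th
coefficient into the sections of `𝒪_X(p^j D)` over `U`, and `W_n(A)` acts on it through `a ↦ a₀ ^
p^j`, that is, through the surjection `W_n(A) → A` followed by an iterate of Frobenius, which is
finite. The sections of `𝒪_X(E)` form a noetherian `A`-module: some nonzero `h` in `A` multiplies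
them into `A`, because a normal noetherian domain is the intersection of its localizations at primes
of height one. Hence `M` is a noetherian `W_n(A)`-module, and `W_n(A)` is a noetherian ring by the
same argument (`isNoetherian_of_coeff_mem`, `isNoetherian_divisorSubmodule`).

The passage to smaller open sets uses the Teichmüller representative `[f]`, which is a unit over
`D(f)` and multiplies the `i`-th coefficient by `f ^ p^i`. A power of it therefore clears
denominators, both for sections of `W_n 𝒪_X(D)` and for Witt vectors over `D(f)`. So finitely many
generators over `U`, of the module or of the relations between given sections, still generate over
each `D(f)`, and the `D(f)` form a basis of `U`. -/

namespace WittDivisorial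

/-! ### Noetherian modules along ring homomorphisms. -/

section NoetherianAlongRingHom

variable {R S T M N : Type*} [CommRing R] [CommRing S] [CommRing T] [AddCommGroup M]
  [AddCommGroup N] [Module R M]

/-- `g` becomes linear once `N` is an `R`-module through `σ`, so `M` is an extension of a submodule
of `N` by a submodule of `K`. The semilinear form is needed because taking a leading Witt
coefficient is linear only up to a power of Frobenius. -/
theorem isNoetherian_of_semilinear [Module S N] (σ : R →+* S)
    (hN : @IsNoetherian R N _ _ (Module.compHom N σ)) (g : M →+ N)
    (hg : ∀ r m, g (r • m) = σ r • g m) (K : Submodule R M) (hK : ∀ m, g m = 0 → m ∈ K)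
    [IsNoetherian R K] : IsNoetherian R M := by
  let := Module.compHom N σ
  let g' : M →ₗ[R] N := { g with map_smul' := hg }
  have hle : LinearMap.ker g' ≤ K := fun m hm => hK m hm
  have : IsNoetherian R (LinearMap.ker g') := isNoetherian_of_le hle
  exact isNoetherian_of_range_eq_ker (LinearMap.ker g').subtype g' (Submodule.range_subtype _)

theorem isNoetherian_compHom_of_finite [Module T N] [IsNoetherianRing S] [Module.Finite T N]
    {φ : S →+* T} (hφ : φ.Finite) : @IsNoetherian S N _ _ (Module.compHom N φ) := by
  let := φ.toAlgebra
  let := Module.compHom N φ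
  have : IsScalarTower S T N := ⟨fun s t n => by
    change (φ s * t) • n = φ s • t • n
    rw [mul_smul]⟩
  have : Module.Finite S T := hφ
  have : Module.Finite S N := Module.Finite.trans T N
  infer_instance

theorem isNoetherian_compHom_of_surjective [Module S N] [IsNoetherian S N] {π : R →+* S}
    (hπ : Function.Surjective π) : @IsNoetherian R N _ _ (Module.compHom N π) := by
  let := Module.compHom N π
  have : RingHomSurjective π := ⟨hπ⟩
  let l : N →ₛₗ[π] N := { AddMonoidHom.id N with map_smul' := fun _ _ => rfl }
  exact (LinearMap.isNoetherian_iff_of_bijective l Function.bijective_id).mpr inferInstance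

/-- The shape of the action on graded pieces: `π` is the projection `W_n(A) → A` and `φ` an iterated
Frobenius of `A`. -/
theorem isNoetherian_compHom_comp [Module T N] [IsNoetherianRing S] [Module.Finite T N]
    {φ : S →+* T} (hφ : φ.Finite) {π : R →+* S} (hπ : Function.Surjective π) :
    @IsNoetherian R N _ _ (Module.compHom N (φ.comp π)) := by
  let := Module.compHom N φ
  have : IsNoetherian S N := isNoetherian_compHom_of_finite hφ
  exact isNoetherian_compHom_of_surjective (S := S) (N := N) hπ

end NoetherianAlongRingHom

/-! ### Truncated Witt vectors filtered by leading zeros. -/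

section Witt

variable (p : ℕ) [Fact p.Prime] {n : ℕ}

theorem finite_iterateFrobenius {A : Type*} [CommRing A] [CharP A p] (h : (frobenius A p).Finite)
    (j : ℕ) : (iterateFrobenius A p j).Finite := by
  induction j with
  | zero =>
    rw [iterateFrobenius_zero]
    exact RingHom.Finite.id A
  | succ j ih =>
    have : iterateFrobenius A p (j + 1) = (frobenius A p).comp (iterateFrobenius A p j) := by
      ext a
      simp [iterateFrobenius_def, frobenius_def, pow_succ, pow_mul]
    rw [this]
    exact h.comp ih

/-- The first coefficient of a truncated Witt vector, as a ring homomorphism. -/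
def truncatedConstantCoeff (hn : 0 < n) (R : Type*) [CommRing R] :
    TruncatedWittVector p n R →+* R where
  toFun x := x.coeff ⟨0, hn⟩
  map_zero' := TruncatedWittVector.coeff_zero p n R _
  map_one' := by
    rw [← map_one (WittVector.truncate (p := p) (R := R) n), WittVector.coeff_truncate]
    exact map_one (WittVector.constantCoeff (p := p))
  map_add' x y := by
    obtain ⟨x, rfl⟩ := WittVector.truncate_surjective p n R x
    obtain ⟨y, rfl⟩ := WittVector.truncate_surjective p n R y
    simp only [← map_add, WittVector.coeff_truncate]
    exact map_add (WittVector.constantCoeff (p := p)) x y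
  map_mul' x y := by
    obtain ⟨x, rfl⟩ := WittVector.truncate_surjective p n R x
    obtain ⟨y, rfl⟩ := WittVector.truncate_surjective p n R y
    simp only [← map_mul, WittVector.coeff_truncate]
    exact map_mul (WittVector.constantCoeff (p := p)) x y

theorem truncatedConstantCoeff_surjective (hn : 0 < n) (R : Type*) [CommRing R] :
    Function.Surjective (truncatedConstantCoeff p hn R) := fun r =>
  ⟨TruncatedWittVector.mk p fun _ => r, rfl⟩

variable {K : Type*} [CommRing K]

/-- Turns a condition on coefficients into membership in the image of `V^j`, where additivity of `V`
and the projection formula are available. -/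
theorem exists_truncate_iterate_verschiebung (x : TruncatedWittVector p n K) {j : ℕ}
    (hx : ∀ i : Fin n, (i : ℕ) < j → x.coeff i = 0) :
    ∃ z : WittVector p K, x = WittVector.truncate n (WittVector.verschiebung^[j] z) := by
  have h : ∀ i < j, x.out.coeff i = 0 := by
    intro i hi
    simp only [TruncatedWittVector.out]
    split_ifs with h
    · exact hx ⟨i, h⟩ hi
    · rfl
  refine ⟨x.out.shift j, ?_⟩
  rw [← WittVector.eq_iterate_verschiebung h]
  exact (TruncatedWittVector.truncateFun_out x).symm

theorem coeff_truncate_iterate_verschiebung_of_lt (z : WittVector p K) {j : ℕ} {i : Fin n}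
    (hi : (i : ℕ) < j) :
    (WittVector.truncate n (WittVector.verschiebung^[j] z)).coeff i = 0 := by
  rw [WittVector.coeff_truncate, WittVector.iterate_verschiebung_coeff_eq_zero z hi]

theorem coeff_truncate_iterate_verschiebung (z : WittVector p K) (j : Fin n) :
    (WittVector.truncate n (WittVector.verschiebung^[(j : ℕ)] z)).coeff j = z.coeff 0 := by
  rw [WittVector.coeff_truncate]
  simpa using WittVector.iterate_verschiebung_coeff z j 0

/-- `V^j` is additive, and so is the zeroth coefficient; Witt addition is thus ordinary addition on
leading coefficients. -/
theorem coeff_add_of_forall_lt {x y : TruncatedWittVector p n K} {j : ℕ}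
    (hx : ∀ i : Fin n, (i : ℕ) < j → x.coeff i = 0)
    (hy : ∀ i : Fin n, (i : ℕ) < j → y.coeff i = 0) :
    (∀ i : Fin n, (i : ℕ) < j → (x + y).coeff i = 0) ∧
      ∀ i : Fin n, (i : ℕ) = j → (x + y).coeff i = x.coeff i + y.coeff i := by
  obtain ⟨x, rfl⟩ := exists_truncate_iterate_verschiebung p x hx
  obtain ⟨y, rfl⟩ := exists_truncate_iterate_verschiebung p y hy
  rw [← map_add, ← iterate_map_add]
  refine ⟨fun i => coeff_truncate_iterate_verschiebung_of_lt p _, ?_⟩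
  rintro i rfl
  simp only [coeff_truncate_iterate_verschiebung]
  exact map_add (WittVector.constantCoeff (p := p)) x y

/-- Projection formula `a · V^j z = V^j (F^j a · z)`; in characteristic `p`, `F` raises each
coefficient to the `p`-th power. -/
theorem coeff_mul_of_forall_lt [CharP K p] (a : TruncatedWittVector p n K)
    {x : TruncatedWittVector p n K} {j : ℕ}
    (hx : ∀ i : Fin n, (i : ℕ) < j → x.coeff i = 0) :
    (∀ i : Fin n, (i : ℕ) < j → (a * x).coeff i = 0) ∧
      ∀ (hn : 0 < n) (i : Fin n), (i : ℕ) = j →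
        (a * x).coeff i = a.coeff ⟨0, hn⟩ ^ p ^ j * x.coeff i := by
  obtain ⟨x, rfl⟩ := exists_truncate_iterate_verschiebung p x hx
  obtain ⟨a, rfl⟩ := WittVector.truncate_surjective p n K a
  rw [← map_mul, mul_comm a, WittVector.iterate_verschiebung_mul_left]
  refine ⟨fun i => coeff_truncate_iterate_verschiebung_of_lt p _, ?_⟩
  rintro hn i rfl
  rw [coeff_truncate_iterate_verschiebung, coeff_truncate_iterate_verschiebung,
    WittVector.coeff_truncate]
  rw [mul_comm, ← WittVector.iterate_frobenius_coeff]
  exact map_mul (WittVector.constantCoeff (p := p)) _ _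

/-- If `A` is noetherian with finite Frobenius, then a `W_n(A)`-submodule of `W_n(K)` whose
coefficients lie in noetherian `A`-submodules of `K` is noetherian. -/
theorem isNoetherian_of_coeff_mem {A M : Type*} [CommRing A] [IsNoetherianRing A] [CharP A p]
    [CharP K p] [Algebra A K] (hF : (frobenius A p).Finite) [AddCommGroup M]
    [Module (TruncatedWittVector p n A) M] (e : M →+ TruncatedWittVector p n K)
    (he : ∀ a m, e (a • m) = truncatedMap p n (algebraMap A K) a * e m)
    (hinj : Function.Injective e) (G : Fin n → Submodule A K) (hG : ∀ m i, (e m).coeff i ∈ G i)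
    (hfin : ∀ i, IsNoetherian A (G i)) : IsNoetherian (TruncatedWittVector p n A) M := by
  let N : ℕ → Submodule (TruncatedWittVector p n A) M := fun j =>
    { carrier := {m | ∀ i : Fin n, (i : ℕ) < j → (e m).coeff i = 0}
      add_mem' := fun {x y} hx hy => by
        rw [Set.mem_ofPred_eq, map_add]
        exact (coeff_add_of_forall_lt p hx hy).1
      zero_mem' := fun i _ => by
        rw [map_zero]
        exact TruncatedWittVector.coeff_zero p n K i
      smul_mem' := fun a x hx => by
        rw [Set.mem_ofPred_eq, he]
        exact (coeff_mul_of_forall_lt p _ hx).1 }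
  -- Descending induction: `N n` is zero by injectivity of `e`, and `N j / N (j + 1)` embeds into `G
  -- j` by the `j`-th coefficient.
  have key : ∀ j, j ≤ n → IsNoetherian (TruncatedWittVector p n A) (N j) := by
    intro j hj
    induction hj using Nat.decreasingInduction with
    | self =>
      have : N n = ⊥ := by
        rw [eq_bot_iff]
        intro m hm
        refine hinj ?_
        rw [map_zero]
        refine TruncatedWittVector.ext fun i => ?_
        rw [hm i i.2, TruncatedWittVector.coeff_zero]
      rw [this]
      infer_instance
    | of_succ j hj ih =>
      have hn : 0 < n := by omega
      have := hfin ⟨j, hj⟩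
      let g : N j →+ G ⟨j, hj⟩ :=
        { toFun := fun m => ⟨(e m.1).coeff ⟨j, hj⟩, hG _ _⟩
          map_zero' := Subtype.ext (by simp)
          map_add' := fun x y => Subtype.ext (by
            simp only [Submodule.coe_add, map_add]
            exact (coeff_add_of_forall_lt p x.2 y.2).2 _ rfl) }
      have hle : N (j + 1) ≤ N j := fun m hm i hi => hm i (by omega)
      have : IsNoetherian (TruncatedWittVector p n A) ((N (j + 1)).submoduleOf (N j)) :=
        isNoetherian_of_linearEquiv (Submodule.submoduleOfEquivOfLe hle).symm
      refine isNoetherian_of_semilinear _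
        (isNoetherian_compHom_comp (finite_iterateFrobenius p hF j)
          (truncatedConstantCoeff_surjective p hn A)) g ?_ ((N (j + 1)).submoduleOf (N j)) ?_
      · intro a m
        refine Subtype.ext ?_
        change (e (a • m.1)).coeff ⟨j, hj⟩ =
          iterateFrobenius A p j (a.coeff ⟨0, hn⟩) • (e m.1).coeff ⟨j, hj⟩
        rw [he, (coeff_mul_of_forall_lt p _ m.2).2 hn _ rfl, truncatedMap_coeff,
          iterateFrobenius_def, Algebra.smul_def, map_pow]
      · intro m hm i hi
        rcases Nat.lt_succ_iff_lt_or_eq.mp hi with h | h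
        · exact m.2 i h
        · rw [show i = ⟨j, hj⟩ from Fin.ext h]
          exact congrArg Subtype.val hm
  have h0 : N 0 = ⊤ := eq_top_iff.mpr fun m _ i hi => absurd hi (Nat.not_lt_zero _)
  have := key 0 (Nat.zero_le n)
  rw [h0] at this
  exact isNoetherian_of_linearEquiv Submodule.topEquiv

theorem isNoetherianRing_truncatedWittVector {A : Type*} [CommRing A] [IsNoetherianRing A]
    [CharP A p] (hF : (frobenius A p).Finite) : IsNoetherianRing (TruncatedWittVector p n A) :=
  isNoetherian_of_coeff_mem p (K := A) (M := TruncatedWittVector p n A) hF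
    (AddMonoidHom.id (TruncatedWittVector p n A))
    (fun a m => by
      refine congrArg (· * m) (TruncatedWittVector.ext fun i => ?_)
      rw [truncatedMap_coeff]
      rfl)
    Function.injective_id (fun _ => ⊤) (fun _ _ => trivial) inferInstance

/-- The truncated Teichmüller representative `(r, 0, …, 0)`. -/
noncomputable def truncatedTeichmuller (n : ℕ) {R : Type*} [CommRing R] :
    R →* TruncatedWittVector p n R :=
  (WittVector.truncate n : WittVector p R →+* _).toMonoidHom.comp (WittVector.teichmuller p)

/-- Multiplication by a Teichmüller representative is diagonal in the coefficients, which lets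
denominators be cleared one coefficient at a time. -/
theorem coeff_truncatedTeichmuller_mul {R : Type*} [CommRing R] (r : R)
    (x : TruncatedWittVector p n R) (i : Fin n) :
    (truncatedTeichmuller p n r * x).coeff i = r ^ p ^ (i : ℕ) * x.coeff i := by
  obtain ⟨x, rfl⟩ := WittVector.truncate_surjective p n R x
  change (WittVector.truncate n (WittVector.teichmuller p r) * _).coeff i = _
  rw [← map_mul, teichmuller_mul, WittVector.coeff_truncate, WittVector.coeff_mk,
    WittVector.coeff_truncate]

theorem truncatedMap_truncatedTeichmuller {R S : Type*} [CommRing R] [CommRing S] (f : R →+* S)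
    (r : R) :
    truncatedMap p n f (truncatedTeichmuller p n r) = truncatedTeichmuller p n (f r) := by
  refine TruncatedWittVector.ext fun i => ?_
  have h : WittVector.map f (WittVector.teichmuller p r) = WittVector.teichmuller p (f r) :=
    WittVector.map_teichmuller p f r
  rw [truncatedMap_coeff]
  change f ((WittVector.truncate n (WittVector.teichmuller p r)).coeff i) =
    (WittVector.truncate n (WittVector.teichmuller p (f r))).coeff i
  rw [← h, WittVector.coeff_truncate, WittVector.coeff_truncate, WittVector.map_coeff]

end Witt

/-! ### Normal noetherian domains and height one primes. -/

/-- A noetherian integrally closed domain is the intersection of its localizations at the prime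
ideals of height one. -/
theorem exists_algebraMap_eq_of_height_eq_one {A K : Type*} [CommRing A] [IsDomain A]
    [IsNoetherianRing A] [IsIntegrallyClosed A] [Field K] [Algebra A K] [IsFractionRing A K]
    (x : K) (h : ∀ P : Ideal A, P.IsPrime → P.height = 1 →
      ∃ s ∉ P, ∃ a, algebraMap A K s * x = algebraMap A K a) :
    ∃ a, algebraMap A K a = x := by
  by_contra hx
  let L : Submodule A K := LinearMap.range (Algebra.linearMap A K)
  have hL : ∀ y, y ∈ L ↔ ∃ a, algebraMap A K a = y := fun y => Iff.rfl
  have hx0 : L.mkQ x ≠ 0 := by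
    rwa [Ne, Submodule.mkQ_apply, Submodule.Quotient.mk_eq_zero, hL]
  -- An associated prime `P` of `K / A` containing all denominators of `x`. It is shown to have
  -- height one, which contradicts `h`.
  obtain ⟨P, hP, hxP⟩ := exists_le_isAssociatedPrime_of_isNoetherianRing A _ hx0
  obtain ⟨hprime, z, hz⟩ := isAssociatedPrime_iff.mp hP
  obtain ⟨y, rfl⟩ := L.mkQ_surjective z
  have hcolon : ∀ (w : K) (r : A), r ∈ (⊥ : Submodule A (K ⧸ L)).colon {L.mkQ w} ↔
      ∃ a, algebraMap A K a = algebraMap A K r * w := by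
    intro w r
    rw [Submodule.mem_colon_singleton, Submodule.mem_bot, ← map_smul, Submodule.mkQ_apply,
      Submodule.Quotient.mk_eq_zero, hL, Algebra.smul_def]
  have hmem : ∀ r, r ∈ P ↔ ∃ a, algebraMap A K a = algebraMap A K r * y := by
    intro r
    rw [hz, hcolon]
  have hy : ¬ ∃ a, algebraMap A K a = y := by
    intro hy
    refine hprime.ne_top ((Ideal.eq_top_iff_one P).mpr ((hmem 1).mpr ?_))
    simpa using hy
  have hPbot : P ≠ ⊥ := by
    obtain ⟨a, b, hb, hab⟩ := IsFractionRing.div_surjective (A := A) y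
    refine (Submodule.ne_bot_iff P).mpr ⟨b, (hmem b).mpr ⟨a, ?_⟩, nonZeroDivisors.ne_zero hb⟩
    rw [← hab, mul_div_cancel₀]
    exact IsFractionRing.to_map_ne_zero_of_mem_nonZeroDivisors hb
  have hinj : Function.Injective (algebraMap A K) := IsFractionRing.injective A K
  -- Otherwise `y P ⊆ P` with `P` finitely generated and nonzero, so `y` is integral over `A` and
  -- hence in `A`.
  have hnot : ∃ t ∈ P, ∃ v ∉ P, algebraMap A K v = algebraMap A K t * y := by
    by_contra! hcon
    refine hy (IsIntegrallyClosed.algebraMap_eq_of_integral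
      (isIntegral_of_smul_mem_submodule (Submodule.map (Algebra.linearMap A K) P) ?_
        ((IsNoetherian.noetherian P).map _) y ?_))
    · rw [Ne, ← Submodule.map_bot (Algebra.linearMap A K)]
      exact fun h => hPbot (Submodule.map_injective_of_injective hinj h)
    · rintro _ ⟨t, ht, rfl⟩
      obtain ⟨v, hv⟩ := (hmem t).mp ht
      refine ⟨v, ?_, ?_⟩
      · by_contra hvP
        exact hcon t ht v hvP hv
      · rw [Algebra.linearMap_apply, hv, smul_eq_mul, mul_comm]
        rfl
  obtain ⟨t, ht, v, hv, htv⟩ := hnot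
  -- For `r ∈ P` the product `r v = t (r y)` lies in `(t)` while `v ∉ P`, so `P` is minimal over
  -- `(t)`; Krull's principal ideal theorem bounds its height.
  have hmin : P ∈ (Ideal.span {t}).minimalPrimes := by
    refine ⟨⟨hprime, (Ideal.span_singleton_le_iff_mem P).mpr ht⟩, fun Q hQ hQP r hr => ?_⟩
    have h1 : r * v ∈ Q := by
      obtain ⟨b, hb⟩ := (hmem r).mp hr
      have : r * v = t * b := hinj (by rw [map_mul, map_mul, htv, hb]; ring)
      rw [this]
      exact Q.mul_mem_right _ ((Ideal.span_singleton_le_iff_mem Q).mp hQ.2)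
    exact (hQ.1.mem_or_mem h1).resolve_right fun hvQ => hv (hQP hvQ)
  have hle := Ideal.height_le_one_of_isPrincipal_of_mem_minimalPrimes (Ideal.span {t}) P hmin
  have hheight : P.height = 1 := by
    refine le_antisymm hle (Order.one_le_iff_ne_zero.mpr ?_)
    rwa [Ne, Ideal.height_eq_zero_iff_eq_bot]
  obtain ⟨s, hs, a, ha⟩ := h P hprime hheight
  exact hs (hxP ((hcolon x s).mpr ⟨a, ha.symm⟩))

/-! ### Divisors and orders of vanishing on an affine open set. -/

section Affine

variable {X : Scheme.{u}} {U : X.Opens}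

theorem primeIdealOf_fromSpec (hU : IsAffineOpen U) (y : PrimeSpectrum Γ(X, U)) :
    ∃ x : U, hU.primeIdealOf x = y := by
  refine ⟨⟨hU.fromSpec y, ?_⟩, ?_⟩
  · have : hU.fromSpec y ∈ hU.fromSpec.opensRange := ⟨y, rfl⟩
    rwa [hU.opensRange_fromSpec] at this
  · exact hU.fromSpec.isOpenEmbedding.injective (hU.fromSpec_primeIdealOf _)

theorem mem_primeIdealOf_iff (hU : IsAffineOpen U) (x : U) (f : Γ(X, U)) :
    f ∈ (hU.primeIdealOf x).asIdeal ↔ x.1 ∉ X.basicOpen f := by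
  have := hU.isLocalization_stalk x
  rw [Scheme.mem_basicOpen' X f x, ← not_iff_not, not_not]
  exact (IsLocalization.AtPrime.isUnit_to_map_iff (X.presheaf.stalk x.1)
    (hU.primeIdealOf x).asIdeal f).symm

/-- Both sides are the Krull dimension of the stalk at `x`. Prime divisors meeting `U` thus
correspond to height one primes. -/
theorem height_primeIdealOf (hU : IsAffineOpen U) (x : U) :
    (hU.primeIdealOf x).asIdeal.height = Order.coheight x.1 := by
  have := hU.isLocalization_stalk x
  have h := IsLocalization.AtPrime.ringKrullDim_eq_height (hU.primeIdealOf x).asIdeal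
    (X.presheaf.stalk x.1)
  rw [ringKrullDim_stalk_eq_coheight] at h
  exact (WithBot.coe_injective h).symm

theorem isIntegrallyClosed_of_isAffineOpen [IsIntegral X] [IsNormalScheme X]
    (hU : IsAffineOpen U) [Nonempty U] : IsIntegrallyClosed Γ(X, U) := by
  refine IsIntegrallyClosed.of_localization_maximal fun q _ hq => ?_
  obtain ⟨x, hx⟩ := primeIdealOf_fromSpec hU ⟨q, hq.isPrime⟩
  have hx' : q = (hU.primeIdealOf x).asIdeal := by rw [hx]
  subst hx'
  have := hU.isLocalization_stalk x
  have := IsNormalScheme.isIntegrallyClosed_stalk (X := X) x.1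
  exact IsIntegrallyClosed.of_equiv (IsLocalization.algEquiv (hU.primeIdealOf x).asIdeal.primeCompl
    (X.presheaf.stalk x.1) (Localization.AtPrime (hU.primeIdealOf x).asIdeal)).toRingEquiv

variable [IsIntegral X] [IsLocallyNoetherian X] [IsNormalScheme X]

theorem exists_stalk_of_ord_nonneg (P : PrimeDivisor X) {φ : X.functionField} (hφ : φ ≠ 0)
    (h : 0 ≤ X.ord φ P.1) : ∃ a, algebraMap (X.presheaf.stalk P.1) X.functionField a = φ := by
  have := isDVR_stalk P
  have : Ring.KrullDimLE 1 (X.presheaf.stalk P.1) := krullDimLE_of_coheight_le P.2.le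
  apply IsDiscreteValuationRing.exists_lift_of_le_one
  rw [Scheme.le_ord_iff P.2 hφ] at h
  have h1 : 1 ≤ Ring.ordFrac (X.presheaf.stalk P.1) φ := h
  rw [Ring.ordFrac_eq_valuation_inv] at h1
  exact (one_le_inv₀ (zero_lt_iff.mpr ((Valuation.ne_zero_iff _).mpr hφ))).mp h1

variable [Nonempty U]

theorem ord_germToFunctionField_nonneg {f : Γ(X, U)} (hf : f ≠ 0) (P : PrimeDivisor X)
    (hP : P.1 ∈ U) : 0 ≤ X.ord (X.germToFunctionField U f) P.1 := by
  have h := germ_mem_divisorSections U f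
    ((map_ne_zero_iff _ (Scheme.germToFunctionField_injective X U)).mpr hf) P hP
  simpa using h

theorem one_le_ord_of_notMem_basicOpen {f : Γ(X, U)} (hf : f ≠ 0) (P : PrimeDivisor X)
    (hP : P.1 ∈ U) (hfP : P.1 ∉ X.basicOpen f) :
    1 ≤ X.ord (X.germToFunctionField U f) P.1 := by
  have hne := (map_ne_zero_iff _ (Scheme.germToFunctionField_injective X U)).mpr hf
  have h0 := ord_germToFunctionField_nonneg hf P hP
  have := isDVR_stalk P
  have : Ring.KrullDimLE 1 (X.presheaf.stalk P.1) := krullDimLE_of_coheight_le P.2.le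
  have h1 : X.ord (X.germToFunctionField U f) P.1 ≠ 0 := by
    intro h1
    rw [Scheme.ord_eq_iff P.2 hne] at h1
    refine hfP ((Scheme.mem_basicOpen X f P.1 hP).mpr ?_)
    refine (Ring.isUnit_iff_ordFrac_one_of_isDiscreteValuationRing (K := X.functionField)).mpr ?_
    rw [Scheme.algebraMap_germ_eq_germToFunctionField X hP]
    exact h1
  omega

/-- Algebraic Hartogs: non-negative order at `P` puts `φ` in the stalk at `P`, which is a
localization at a height one prime, and these localizations intersect in the ring of sections. -/
theorem exists_germToFunctionField_eq (hU : IsAffineOpen U) {φ : X.functionField}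
    (h : φ ≠ 0 → ∀ P : PrimeDivisor X, P.1 ∈ U → 0 ≤ X.ord φ P.1) :
    ∃ a, X.germToFunctionField U a = φ := by
  by_cases hφ : φ = 0
  · exact ⟨0, by rw [hφ, map_zero]⟩
  have := isIntegrallyClosed_of_isAffineOpen hU
  have : IsNoetherianRing Γ(X, U) :=
    IsLocallyNoetherian.component_noetherian ⟨U, hU⟩
  have := functionField_isFractionRing_of_isAffineOpen X U hU
  refine exists_algebraMap_eq_of_height_eq_one (A := Γ(X, U)) φ fun Q hQ hQ1 => ?_
  obtain ⟨x, hx⟩ := primeIdealOf_fromSpec hU ⟨Q, hQ⟩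
  have hx' : Q = (hU.primeIdealOf x).asIdeal := by rw [hx]
  subst hx'
  rw [height_primeIdealOf] at hQ1
  obtain ⟨b, hb⟩ := exists_stalk_of_ord_nonneg ⟨x.1, hQ1⟩ hφ (h hφ ⟨x.1, hQ1⟩ x.2)
  have := hU.isLocalization_stalk x
  obtain ⟨⟨a, s⟩, has⟩ := IsLocalization.surj (hU.primeIdealOf x).asIdeal.primeCompl b
  refine ⟨s.1, s.2, a, ?_⟩
  have h1 := congrArg (algebraMap (X.presheaf.stalk x.1) X.functionField) has
  rw [map_mul, hb, ← IsScalarTower.algebraMap_apply, ← IsScalarTower.algebraMap_apply] at h1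
  rw [← h1, mul_comm]

theorem exists_ord_ge (hU : IsAffineOpen U) (E : RDivisor X) (S : Finset (PrimeDivisor X)) :
    ∃ h : Γ(X, U), h ≠ 0 ∧ ∀ P ∈ S, P.1 ∈ U → E P ≤ X.ord (X.germToFunctionField U h) P.1 := by
  classical
  have hinj := Scheme.germToFunctionField_injective X U
  induction S using Finset.induction_on with
  | empty => exact ⟨1, one_ne_zero, fun P hP => absurd hP (Finset.notMem_empty P)⟩
  | insert P S _ ih =>
    obtain ⟨h, hh, hS⟩ := ih
    by_cases hP : P.1 ∈ U
    · have hbot : (hU.primeIdealOf ⟨P.1, hP⟩).asIdeal ≠ ⊥ := by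
        intro hbot
        have := height_primeIdealOf hU ⟨P.1, hP⟩
        rw [hbot, Ideal.height_bot, P.2] at this
        exact zero_ne_one this
      obtain ⟨t, htP, ht⟩ := (Submodule.ne_bot_iff _).mp hbot
      have ht1 := one_le_ord_of_notMem_basicOpen ht P hP
        ((mem_primeIdealOf_iff hU ⟨P.1, hP⟩ t).mp htP)
      have hpow : ∀ (N : ℕ), ∀ Q : PrimeDivisor X, Q.1 ∈ U →
          X.ord (X.germToFunctionField U (h * t ^ N)) Q.1 =
          X.ord (X.germToFunctionField U h) Q.1 + N * X.ord (X.germToFunctionField U t) Q.1 := by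
        intro N Q hQ
        induction N with
        | zero => simp
        | succ N ihN =>
          rw [pow_succ, ← mul_assoc, map_mul, Scheme.ord_mul
            ((map_ne_zero_iff _ hinj).mpr (mul_ne_zero hh (pow_ne_zero N ht)))
            ((map_ne_zero_iff _ hinj).mpr ht), ihN]
          push_cast
          ring
      -- `t` has order at least `1` at `P`, which settles `P`, and non-negative order elsewhere on
      -- `U`, which preserves the bounds on `S`.
      refine ⟨h * t ^ ⌈E P⌉₊, mul_ne_zero hh (pow_ne_zero _ ht), fun Q hQ hQU => ?_⟩
      rw [hpow _ _ hQU]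
      have h1 := ord_germToFunctionField_nonneg hh Q hQU
      have h2 := ord_germToFunctionField_nonneg ht Q hQU
      rcases Finset.mem_insert.mp hQ with rfl | hQS
      · have h3 : (⌈E Q⌉₊ : ℤ) ≤ X.ord (X.germToFunctionField U h) Q.1 +
            ⌈E Q⌉₊ * X.ord (X.germToFunctionField U t) Q.1 := by nlinarith
        have h4 : ((⌈E Q⌉₊ : ℤ) : ℝ) ≤ _ := Int.cast_le.mpr h3
        exact (Nat.le_ceil _).trans (by exact_mod_cast h4)
      · have h3 : X.ord (X.germToFunctionField U h) Q.1 ≤ X.ord (X.germToFunctionField U h) Q.1 +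
            ⌈E P⌉₊ * X.ord (X.germToFunctionField U t) Q.1 := by
          have : (0 : ℤ) ≤ ⌈E P⌉₊ * X.ord (X.germToFunctionField U t) Q.1 := by positivity
          omega
        exact (hS Q hQS hQU).trans (Int.cast_le.mpr h3)
    · refine ⟨h, hh, fun Q hQ hQU => ?_⟩
      rcases Finset.mem_insert.mp hQ with rfl | hQS
      · exact absurd hQU hP
      · exact hS Q hQS hQU

/-- The sections of `𝒪_X(E)` over `U` as a `Γ(X, U)`-submodule of the function field. -/
noncomputable def divisorSubmodule (E : RDivisor X) (U : X.Opens) [Nonempty U] :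
    Submodule Γ(X, U) X.functionField where
  __ := divisorSections E U
  smul_mem' a φ hφ := by
    have := mul_mem_divisorSections (zero_add E) (germ_mem_divisorSections U a) hφ
    exact this

/-- Multiplication by an `h` vanishing to order at least `E` along its support embeds the module
into the noetherian ring of sections. -/
theorem isNoetherian_divisorSubmodule (hU : IsAffineOpen U) (E : RDivisor X) :
    IsNoetherian Γ(X, U) (divisorSubmodule E U) := by
  have : IsNoetherianRing Γ(X, U) :=
    IsLocallyNoetherian.component_noetherian ⟨U, hU⟩
  obtain ⟨h, hh, hE⟩ := exists_ord_ge hU E E.support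
  have hh' := (map_ne_zero_iff _ (Scheme.germToFunctionField_injective X U)).mpr hh
  let g : X.functionField →ₗ[Γ(X, U)] X.functionField :=
    LinearMap.mulLeft Γ(X, U) (X.germToFunctionField U h)
  have hg : ∀ φ ∈ divisorSubmodule E U,
      g φ ∈ LinearMap.range (Algebra.linearMap Γ(X, U) X.functionField) := by
    intro φ hφ
    refine exists_germToFunctionField_eq hU fun hne P hP => ?_
    have hφ0 : φ ≠ 0 := right_ne_zero_of_mul hne
    change 0 ≤ X.ord (X.germToFunctionField U h * φ) P.1
    rw [Scheme.ord_mul hh' hφ0]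
    have h1 : 0 ≤ (X.ord φ P.1 : ℝ) + E P := hφ hφ0 P hP
    have h2 : E P ≤ X.ord (X.germToFunctionField U h) P.1 := by
      by_cases hPE : P ∈ E.support
      · exact hE P hPE hP
      · rw [Finsupp.notMem_support_iff.mp hPE]
        exact_mod_cast ord_germToFunctionField_nonneg hh P hP
    have h3 : (0 : ℝ) ≤ ((X.ord (X.germToFunctionField U h) P.1 + X.ord φ P.1 : ℤ) : ℝ) := by
      push_cast
      linarith
    exact_mod_cast h3
  refine isNoetherian_of_injective (g.restrict hg) ?_
  intro φ ψ hφψ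
  exact Subtype.ext (mul_left_cancel₀ hh' (congrArg Subtype.val hφψ))

/-- Such divisors are height one primes containing `f ≠ 0`, hence minimal over `(f)`, and a
noetherian ring has finitely many of those. -/
theorem finite_primeDivisor_notMem_basicOpen (hU : IsAffineOpen U) {f : Γ(X, U)} (hf : f ≠ 0) :
    {P : PrimeDivisor X | P.1 ∈ U ∧ P.1 ∉ X.basicOpen f}.Finite := by
  have : IsNoetherianRing Γ(X, U) :=
    IsLocallyNoetherian.component_noetherian ⟨U, hU⟩
  let Z : Set (PrimeSpectrum Γ(X, U)) := {q | q.asIdeal ∈ (Ideal.span {f}).minimalPrimes}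
  have hZ : Z.Finite := (Ideal.finite_minimalPrimes_of_isNoetherianRing _ _).preimage
    fun q _ q' _ h => PrimeSpectrum.ext h
  refine ((hZ.image hU.fromSpec).preimage Subtype.val_injective.injOn).subset ?_
  rintro P ⟨hP, hfP⟩
  refine ⟨hU.primeIdealOf ⟨P.1, hP⟩, ?_, hU.fromSpec_primeIdealOf ⟨P.1, hP⟩⟩
  refine Ideal.mem_minimalPrimes_of_height_le ?_ ?_
  · exact (Ideal.span_singleton_le_iff_mem _).mpr ((mem_primeIdealOf_iff hU ⟨P.1, hP⟩ f).mpr hfP)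
  · rw [height_primeIdealOf, P.2]
    exact Ideal.one_le_height_span_singleton_of_mem_nonZeroDivisors
      (mem_nonZeroDivisors_of_ne_zero hf)

/-- A section of `𝒪_X(E)` over `D(f)` extends to `U` after multiplication by a power of `f`. -/
theorem exists_pow_mul_mem_divisorSections (hU : IsAffineOpen U) {f : Γ(X, U)} (hf : f ≠ 0)
    (E : RDivisor X) {φ : X.functionField} (hφ : φ ∈ divisorSections E (X.basicOpen f)) :
    ∃ k, ∀ l, k ≤ l → X.germToFunctionField U f ^ l * φ ∈ divisorSections E U := by
  have hf' := (map_ne_zero_iff _ (Scheme.germToFunctionField_injective X U)).mpr hf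
  -- `k` bounds the deficit `-(ord φ + E)` at the finitely many prime divisors of `U` outside
  -- `D(f)`, where `f` has order at least `1`.
  obtain ⟨k, hk⟩ := ((finite_primeDivisor_notMem_basicOpen hU hf).image
    fun P => ⌈-((X.ord φ P.1 : ℝ) + E P)⌉₊).bddAbove
  refine ⟨k, fun l hl hne P hP => ?_⟩
  have hφ0 : φ ≠ 0 := right_ne_zero_of_mul hne
  have hpow : X.ord (X.germToFunctionField U f ^ l) P.1 =
      l * X.ord (X.germToFunctionField U f) P.1 := by
    have h1 : X.ord (1 : X.functionField) P.1 = 0 := by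
      have h2 : X.ord (1 * 1 : X.functionField) P.1 = X.ord 1 P.1 := by rw [one_mul]
      rw [Scheme.ord_mul one_ne_zero one_ne_zero] at h2
      omega
    clear hl hne
    induction l with
    | zero => simp [h1]
    | succ l ih =>
      rw [pow_succ, Scheme.ord_mul (pow_ne_zero l hf') hf', ih]
      push_cast
      ring
  rw [Scheme.ord_mul (pow_ne_zero l hf') hφ0, hpow]
  push_cast
  by_cases hfP : P.1 ∈ X.basicOpen f
  · have h1 : 0 ≤ (X.ord φ P.1 : ℝ) + E P := hφ hφ0 P hfP
    have h2 : (0 : ℝ) ≤ X.ord (X.germToFunctionField U f) P.1 :=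
      Int.cast_nonneg (ord_germToFunctionField_nonneg hf P hP)
    have h3 : (0 : ℝ) ≤ l * X.ord (X.germToFunctionField U f) P.1 := by positivity
    linarith
  · have h1 : (1 : ℝ) ≤ X.ord (X.germToFunctionField U f) P.1 := by
      exact_mod_cast one_le_ord_of_notMem_basicOpen hf P hP hfP
    have h2 : ⌈-((X.ord φ P.1 : ℝ) + E P)⌉₊ ≤ k := hk ⟨P, ⟨hP, hfP⟩, rfl⟩
    have h3 : -((X.ord φ P.1 : ℝ) + E P) ≤ l :=
      (Nat.le_ceil _).trans (Nat.cast_le.mpr (h2.trans hl))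
    have h4 : (l : ℝ) ≤ l * X.ord (X.germToFunctionField U f) P.1 :=
      le_mul_of_one_le_right (Nat.cast_nonneg l) h1
    linarith

end Affine

/-! ### Witt vectors over an affine open set and over `D(f)`. -/

section Ring

variable (p : ℕ) [Fact p.Prime] (n : ℕ) {X : Scheme.{u}} {U : X.Opens}

theorem charP_sections [IsFpScheme p X] (U : X.Opens) [Nonempty U] : CharP Γ(X, U) p :=
  (CharP.charP_iff_prime_eq_zero Fact.out).mpr (natCast_eq_zero p X U)

theorem finite_frobenius_sections [IsFpScheme p X] [IsFFinite p X] (hU : IsAffineOpen U)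
    [CharP Γ(X, U) p] : (frobenius Γ(X, U) p).Finite := by
  have h : (powHom p (natCast_eq_zero p X U)).Finite :=
    (IsFFinite.isFinite_absFrobenius (p := p) (X := X)).finite_app U hU
  have h' : frobenius Γ(X, U) p = powHom p (natCast_eq_zero p X U) := RingHom.ext fun _ => rfl
  rwa [h']

/-- The Teichmüller representative of `f` over `D(f)`. -/
noncomputable def basicOpenTeichmuller (f : Γ(X, U)) :
    TruncatedWittVector p n Γ(X, X.basicOpen f) :=
  truncatedTeichmuller p n (X.presheaf.map (homOfLE (X.basicOpen_le f)).op f)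

theorem isUnit_basicOpenTeichmuller (f : Γ(X, U)) : IsUnit (basicOpenTeichmuller p n f) :=
  (RingedSpace.isUnit_res_basicOpen X.toRingedSpace f).map (truncatedTeichmuller p n)

theorem exists_truncatedMap_eq_pow_mul (hU : IsAffineOpen U) {f : Γ(X, U)} {r : ℕ}
    (a : Fin r → TruncatedWittVector p n Γ(X, X.basicOpen f)) :
    ∃ (k : ℕ) (b : Fin r → TruncatedWittVector p n Γ(X, U)), ∀ j,
      truncatedMap p n (X.presheaf.map (homOfLE (X.basicOpen_le f)).op).hom (b j) =
        basicOpenTeichmuller p n f ^ k * a j := by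
  have := hU.isLocalization_basicOpen f
  have hsurj : ∀ z : Γ(X, X.basicOpen f), ∃ k : ℕ, ∀ l, k ≤ l → ∃ b : Γ(X, U),
      X.presheaf.map (homOfLE (X.basicOpen_le f)).op b =
        X.presheaf.map (homOfLE (X.basicOpen_le f)).op f ^ l * z := by
    intro z
    obtain ⟨k, b, hb⟩ := IsLocalization.Away.surj f z
    refine ⟨k, fun l hl => ⟨f ^ (l - k) * b, ?_⟩⟩
    obtain ⟨d, rfl⟩ := Nat.exists_eq_add_of_le hl
    rw [Nat.add_sub_cancel_left, map_mul, map_pow, pow_add]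
    have hb' : z * X.presheaf.map (homOfLE (X.basicOpen_le f)).op f ^ k =
      X.presheaf.map (homOfLE (X.basicOpen_le f)).op b := hb
    rw [← hb']
    ring
  choose k hk using fun (x : Fin r × Fin n) => hsurj ((a x.1).coeff x.2)
  let l := Finset.univ.sup k
  -- `[f] ^ l` multiplies coefficient `i` by `f ^ (l * p ^ i)`, and `l * p ^ i ≥ l`, so one `l`
  -- serves all coefficients of all vectors.
  have hl : ∀ (j : Fin r) (i : Fin n), ∃ b : Γ(X, U), X.presheaf.map (homOfLE (X.basicOpen_le f)).op b =
      X.presheaf.map (homOfLE (X.basicOpen_le f)).op f ^ (l * p ^ (i : ℕ)) * (a j).coeff i :=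
    fun j i => hk (j, i) _ ((Finset.le_sup (Finset.mem_univ (j, i))).trans
      (Nat.le_mul_of_pos_right _ (pow_pos (Fact.out : p.Prime).pos _)))
  choose b hb using hl
  refine ⟨l, fun j => TruncatedWittVector.mk p (b j), fun j => TruncatedWittVector.ext fun i => ?_⟩
  rw [truncatedMap_coeff, basicOpenTeichmuller, ← map_pow, coeff_truncatedTeichmuller_mul,
    ← pow_mul]
  exact hb j i

theorem isNoetherianRing_witt_sections [Nonempty U] [IsLocallyNoetherian X] [IsFpScheme p X] [IsFFinite p X]
    (hU : IsAffineOpen U) : IsNoetherianRing (TruncatedWittVector p n Γ(X, U)) := by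
  have : IsNoetherianRing Γ(X, U) :=
    IsLocallyNoetherian.component_noetherian ⟨U, hU⟩
  have := charP_sections p U
  exact isNoetherianRing_truncatedWittVector p (finite_frobenius_sections p hU)

theorem ne_zero_of_nonempty_basicOpen {f : Γ(X, U)} [Nonempty (X.basicOpen f)] : f ≠ 0 := by
  rintro rfl
  obtain ⟨x, hx⟩ := ‹Nonempty (X.basicOpen (0 : Γ(X, U)))›
  rw [Scheme.basicOpen_zero] at hx
  exact hx

end Ring

theorem genericPoint_mem {X : Scheme.{u}} [IsIntegral X] (U : X.Opens) [h : Nonempty U] : genericPoint X ∈ U :=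
  ((genericPoint_spec X).mem_open_set_iff U.isOpen).mpr (by simpa using h)

/-! ### Sections of `W_n 𝒪_X(D)` over affine open sets. -/

section Sections

variable (p : ℕ) [Fact p.Prime] (n : ℕ) {X : Scheme.{u}} [IsIntegral X] [IsLocallyNoetherian X]
  [IsNormalScheme X] (D : RDivisor X)

/-- Evaluation of a section of `W_n 𝒪_X(D)` at the generic point. -/
noncomputable def genericEval (U : X.Opens) [Nonempty U] :
    wittDivisorialSections p n D U →+ TruncatedWittVector p n X.functionField where
  toFun s := s.1 ⟨genericPoint X, genericPoint_mem U⟩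
  map_zero' := rfl
  map_add' _ _ := rfl

theorem genericEval_smul (U : X.Opens) [Nonempty U] (a : TruncatedWittVector p n Γ(X, U))
    (s : wittDivisorialSections p n D U) : genericEval p n D U (a • s) =
      truncatedMap p n (X.germToFunctionField U).hom a * genericEval p n D U s :=
  rfl

/-- `U` is irreducible, hence connected, so a locally constant function on it is determined by one
value. -/
theorem genericEval_injective (U : X.Opens) [Nonempty U] :
    Function.Injective (genericEval p n D U) := by
  intro s t h
  have : PreconnectedSpace U := Subtype.preconnectedSpace
    ((PreirreducibleSpace.isPreirreducible_univ.open_subset U.isOpen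
      (Set.subset_univ _)).isPreconnected)
  refine Subtype.ext (LocallyConstant.ext fun x => ?_)
  let η : U := ⟨genericPoint X, genericPoint_mem U⟩
  exact (s.1.isLocallyConstant.apply_eq_of_preconnectedSpace x η).trans
    (Eq.trans h (t.1.isLocallyConstant.apply_eq_of_preconnectedSpace x η).symm)

theorem coeff_genericEval_mem (U : X.Opens) [Nonempty U] (s : wittDivisorialSections p n D U)
    (i : Fin n) :
    (genericEval p n D U s).coeff i ∈ divisorSections ((p : ℝ) ^ (i : ℕ) • D) U :=
  s.2 _ i

theorem exists_genericEval_eq (U : X.Opens) [Nonempty U]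
    (w : TruncatedWittVector p n X.functionField)
    (hw : ∀ i : Fin n, w.coeff i ∈ divisorSections ((p : ℝ) ^ (i : ℕ) • D) U) :
    ∃ s, genericEval p n D U s = w :=
  ⟨⟨LocallyConstant.const U w, fun _ i => hw i⟩, rfl⟩

theorem genericEval_res {U V : X.Opens} [Nonempty U] [Nonempty V] (h : V ≤ U)
    (s : wittDivisorialSections p n D U) :
    genericEval p n D V (wittDivisorialRes p n D h s) = genericEval p n D U s :=
  rfl

theorem wittDivisorialRes_injective {U V : X.Opens} [Nonempty U] [Nonempty V] (h : V ≤ U) :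
    Function.Injective (wittDivisorialRes p n D h) := fun s t hst =>
  genericEval_injective p n D U (by
    rw [← genericEval_res p n D h, hst, genericEval_res])

theorem wittDivisorialRes_smul {U V : X.Opens} [Nonempty U] [Nonempty V] (h : V ≤ U)
    (a : TruncatedWittVector p n Γ(X, U)) (s : wittDivisorialSections p n D U) :
    wittDivisorialRes p n D h (a • s) =
      truncatedMap p n (X.presheaf.map (homOfLE h).op).hom a • wittDivisorialRes p n D h s := by
  refine genericEval_injective p n D V ?_
  rw [genericEval_res, genericEval_smul, genericEval_smul, genericEval_res]
  refine congrArg (· * _) (TruncatedWittVector.ext fun i => ?_)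
  rw [truncatedMap_coeff, truncatedMap_coeff, truncatedMap_coeff]
  exact (X.presheaf.germ_res_apply (homOfLE h) _ _ _).symm

section Affine

variable {U : X.Opens}

variable [Nonempty U]

theorem isNoetherian_wittDivisorialSections [IsFpScheme p X] [IsFFinite p X]
    (hU : IsAffineOpen U) :
    IsNoetherian (TruncatedWittVector p n Γ(X, U)) (wittDivisorialSections p n D U) := by
  have : IsNoetherianRing Γ(X, U) :=
    IsLocallyNoetherian.component_noetherian ⟨U, hU⟩
  have := charP_sections p U
  have : CharP X.functionField p :=
    charP_of_injective_ringHom (Scheme.germToFunctionField_injective X U) p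
  exact isNoetherian_of_coeff_mem p (finite_frobenius_sections p hU) (genericEval p n D U)
    (genericEval_smul p n D U) (genericEval_injective p n D U)
    (fun i => divisorSubmodule ((p : ℝ) ^ (i : ℕ) • D) U) (coeff_genericEval_mem p n D U)
    fun i => isNoetherian_divisorSubmodule hU _

variable {f : Γ(X, U)} [Nonempty (X.basicOpen f)]

/-- Poles along the prime divisors outside `D(f)` are cleared in each coefficient separately; the
largest exponent works for all since `p ^ i ≥ 1`. -/
theorem exists_res_eq_pow_smul (hU : IsAffineOpen U)
    (m : wittDivisorialSections p n D (X.basicOpen f)) :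
    ∃ (k : ℕ) (s : wittDivisorialSections p n D U),
      wittDivisorialRes p n D (X.basicOpen_le f) s = basicOpenTeichmuller p n f ^ k • m := by
  choose k hk using fun i => exists_pow_mul_mem_divisorSections hU
    (ne_zero_of_nonempty_basicOpen (f := f)) _ (coeff_genericEval_mem p n D _ m i)
  let l := Finset.univ.sup k
  obtain ⟨s, hs⟩ := exists_genericEval_eq p n D U
    (truncatedTeichmuller p n (X.germToFunctionField U f ^ l) * genericEval p n D _ m) (by
      intro i
      rw [coeff_truncatedTeichmuller_mul, ← pow_mul]
      refine hk i _ ((Finset.le_sup (Finset.mem_univ i)).trans ?_)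
      exact Nat.le_mul_of_pos_right _ (pow_pos (Fact.out : p.Prime).pos _))
  refine ⟨l, s, genericEval_injective p n D _ ?_⟩
  rw [genericEval_res, hs, genericEval_smul, map_pow, map_pow, basicOpenTeichmuller,
    truncatedMap_truncatedTeichmuller]
  congr 3
  exact (X.presheaf.germ_res_apply (homOfLE (X.basicOpen_le f)) _ _ _).symm

end Affine

end Sections

theorem map_mem_span_range {R S M N ι : Type*} [CommRing R] [CommRing S] [AddCommGroup M]
    [AddCommGroup N] [Module R M] [Module S N] (σ : R →+* S) (g : M →+ N)
    (hg : ∀ r m, g (r • m) = σ r • g m) {s : ι → M} {m : M}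
    (hm : m ∈ Submodule.span R (Set.range s)) :
    g m ∈ Submodule.span S (Set.range fun i => g (s i)) := by
  induction hm using Submodule.span_induction with
  | mem _ h =>
    obtain ⟨i, rfl⟩ := h
    exact Submodule.subset_span ⟨i, rfl⟩
  | zero =>
    rw [map_zero]
    exact zero_mem _
  | add _ _ _ _ hx hy =>
    rw [map_add]
    exact add_mem hx hy
  | smul a _ _ hx =>
    rw [hg]
    exact Submodule.smul_mem _ _ hx

/-! ### Coherence. -/

section Coherent

variable (p : ℕ) [Fact p.Prime] (n : ℕ) {X : Scheme.{u}} [IsIntegral X] [IsLocallyNoetherian X]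
  [IsNormalScheme X] [IsFpScheme p X] [IsFFinite p X] (D : RDivisor X) {U : X.Opens}

theorem exists_generators [Nonempty U] (hU : IsAffineOpen U) :
    ∃ (k : ℕ) (s : Fin k → wittDivisorialSections p n D U),
      ∀ (V : X.Opens) (hV : V ≤ U) (m : wittDivisorialSections p n D V), ∀ y ∈ V,
        ∃ (W : X.Opens) (hW : W ≤ V), y ∈ W ∧
          wittDivisorialRes p n D hW m ∈ Submodule.span (TruncatedWittVector p n Γ(X, W))
            (Set.range fun i => wittDivisorialRes p n D (hW.trans hV) (s i)) := by
  have := isNoetherian_wittDivisorialSections p n D hU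
  obtain ⟨k, s, hs⟩ := Submodule.fg_iff_exists_fin_generating_family.mp
    (IsNoetherian.noetherian (⊤ : Submodule (TruncatedWittVector p n Γ(X, U))
      (wittDivisorialSections p n D U)))
  refine ⟨k, s, fun V hV m y hy => ?_⟩
  obtain ⟨f, hfV, hyf⟩ := hU.exists_basicOpen_le ⟨y, hy⟩ (hV hy)
  have : Nonempty (X.basicOpen f) := ⟨⟨y, hyf⟩⟩
  have : Nonempty V := ⟨⟨y, hy⟩⟩
  refine ⟨X.basicOpen f, hfV, hyf, ?_⟩
  -- Up to the unit `[f] ^ l`, the section is the restriction of some `t` over `U`, which is a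
  -- combination of the generators.
  obtain ⟨l, t, ht⟩ := exists_res_eq_pow_smul p n D hU (wittDivisorialRes p n D hfV m)
  rw [← Submodule.smul_mem_iff_of_isUnit _ ((isUnit_basicOpenTeichmuller p n f).pow l), ← ht]
  exact map_mem_span_range _ _ (wittDivisorialRes_smul p n D _) (hs ▸ Submodule.mem_top)

theorem exists_relation_generators [Nonempty U] (hU : IsAffineOpen U) {k : ℕ}
    (s : Fin k → wittDivisorialSections p n D U) :
    ∃ (l : ℕ) (r : Fin l → Fin k → TruncatedWittVector p n Γ(X, U)),
      (∀ j, ∑ i, r j i • s i = 0) ∧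
      ∀ (V : X.Opens) (hV : V ≤ U) (a : Fin k → TruncatedWittVector p n Γ(X, V)),
        ∑ i, a i • wittDivisorialRes p n D hV (s i) = 0 → ∀ y ∈ V,
        ∃ (W : X.Opens) (hW : W ≤ V), y ∈ W ∧
          (fun i => truncatedMap p n (X.presheaf.map (homOfLE hW).op).hom (a i)) ∈
            Submodule.span (TruncatedWittVector p n Γ(X, W)) (Set.range fun (j : Fin l) i =>
              truncatedMap p n (X.presheaf.map (homOfLE (hW.trans hV)).op).hom (r j i)) := by
  have := isNoetherianRing_witt_sections p n hU
  let N := LinearMap.ker (Fintype.linearCombination (TruncatedWittVector p n Γ(X, U)) s)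
  have hN : ∀ b, b ∈ N ↔ ∑ i, b i • s i = 0 := fun b => Iff.rfl
  obtain ⟨l, r, hr⟩ := Submodule.fg_iff_exists_fin_generating_family.mp
    (IsNoetherian.noetherian N)
  refine ⟨l, r, fun j => (hN _).mp (hr ▸ Submodule.subset_span ⟨j, rfl⟩),
    fun V hV a ha y hy => ?_⟩
  obtain ⟨f, hfV, hyf⟩ := hU.exists_basicOpen_le ⟨y, hy⟩ (hV hy)
  have : Nonempty (X.basicOpen f) := ⟨⟨y, hyf⟩⟩
  have : Nonempty V := ⟨⟨y, hy⟩⟩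
  refine ⟨X.basicOpen f, hfV, hyf, ?_⟩
  obtain ⟨d, b, hb⟩ := exists_truncatedMap_eq_pow_mul p n hU
    fun i => truncatedMap p n (X.presheaf.map (homOfLE hfV).op).hom (a i)
  -- Restriction to the nonempty `D(f)` is injective, so the relation may be checked there, where it
  -- is `[f] ^ d` times the given one.
  have hbN : b ∈ N := by
    rw [hN]
    refine wittDivisorialRes_injective p n D (X.basicOpen_le f) ?_
    have h := congrArg (wittDivisorialRes p n D hfV) ha
    simp only [map_sum, map_zero, wittDivisorialRes_smul] at h ⊢
    rw [← smul_zero (basicOpenTeichmuller p n f ^ d), ← h, Finset.smul_sum]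
    refine Finset.sum_congr rfl fun i _ => ?_
    rw [hb, mul_smul]
    rfl
  rw [← Submodule.smul_mem_iff_of_isUnit _ ((isUnit_basicOpenTeichmuller p n f).pow d)]
  let ρ := truncatedMap p n (X.presheaf.map (homOfLE (X.basicOpen_le f)).op).hom
  have h := map_mem_span_range ρ (ρ.toAddMonoidHom.compLeft (Fin k))
    (fun c v => funext fun i => map_mul ρ c (v i)) (hr ▸ hbN)
  have e : ρ.toAddMonoidHom.compLeft (Fin k) b = basicOpenTeichmuller p n f ^ d • fun i =>
      truncatedMap p n (X.presheaf.map (homOfLE hfV).op).hom (a i) := funext hb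
  rw [e] at h
  exact h

theorem isCoherent_wittDivisorialSheaf : IsCoherent (wittDivisorialSheaf p n D) where
  isOfFiniteType x := by
    obtain ⟨_, ⟨U, hU, rfl⟩, hxU, -⟩ := X.isBasis_affineOpens.exists_subset_of_mem_open
      (Set.mem_univ x) isOpen_univ
    have : Nonempty U := ⟨⟨x, hxU⟩⟩
    exact ⟨U, hxU, exists_generators p n D hU⟩
  relationsOfFiniteType U k s x hx := by
    obtain ⟨_, ⟨V, hV, rfl⟩, hxV, hVU⟩ := X.isBasis_affineOpens.exists_subset_of_mem_open
      hx U.isOpen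
    have : Nonempty V := ⟨⟨x, hxV⟩⟩
    -- Over open subsets of `V`, the relations between the `s i` are those between their
    -- restrictions to the affine `V`.
    exact ⟨V, hVU, hxV, exists_relation_generators p n D hV
      fun i => wittDivisorialRes p n D hVU (s i)⟩

end Coherent

end WittDivisorial

theorem mainTheorem5 (p : ℕ) [Fact p.Prime] (X : AlgebraicGeometry.Scheme.{u})
    [AlgebraicGeometry.IsIntegral X] [WittDivisorial.IsNormalScheme X]
    [AlgebraicGeometry.IsNoetherian X] [WittDivisorial.IsFpScheme p X]
    [WittDivisorial.IsFFinite p X] (D : WittDivisorial.RDivisor X) (n : ℕ) (hn : 1 ≤ n) :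
    WittDivisorial.IsCoherent (WittDivisorial.wittDivisorialSheaf p n D) :=
  WittDivisorial.isCoherent_wittDivisorialSheaf p n D
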